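/- Let $\kappa$ be a regular uncountable cardinal and let $\chi\le\kappa$ be a (possibly finite) cardinal. Cardinals are identified with initial ordinals. Write $[\kappa]^2=\{(\alpha,\beta)\mid\alpha<\beta<\kappa\}$ and, for $a,b\subseteq\kappa$, write $a<b$ if $\alpha<\beta$ for all $\alpha\in a$ and $\beta\in b$. For a cardinal $\theta\le\kappa$, $\mathrm{pl}_1(\kappa,\theta,\chi)$ asserts that there is a function $\mathbf t:[\kappa]^2\to\kappa\times\kappa\times\kappa$ such that: (i) for all $(\alpha,\beta)\in[\kappa]^2$, if $\mathbf t(\alpha,\beta)=(\tau^*,\alpha^*,\beta^*)$, then $\tau^*\le\alpha^*\le\alpha<\beta^*\le\beta$; (ii) for every ordinal $\sigma<\chi$ and every family $\mathcal A$ of $\kappa$ many pairwise disjoint subsets of $\kappa$, each of order type $\sigma$, there is a stationary set $S\subseteq\kappa$ such that for all $\alpha^*<\beta^*$ in $S$ and every $\tau^*<\min\{\theta,\alpha^*\}$ there are $a,b\in\mathcal A$ with $a<b$ and $\mathbf t[a\times b]=\{(\tau^*,\alpha^*,\beta^*)\}$. For a cardinal $\theta\le\kappa$, $\mathrm{pr}_1(\kappa,\kappa,\theta,\chi)$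 asserts that there is a colouring $c:[\kappa]^2\to\theta$ such that for every ordinal $\sigma<\chi$, every family $\mathcal A$ of $\kappa$ many pairwise disjoint subsets of $\kappa$, each of order type $\sigma$, and every $i<\theta$, there are $a,b\in\mathcal A$ with $a<b$ and $c[a\times b]=\{i\}$. Then: if $\mathrm{pl}_1(\kappa,1,\chi)$ holds, then so does $\mathrm{pr}_1(\kappa,\kappa,\omega,\chi)$. -/

import Mathlib

universe u

/-- `a < b` for sets of ordinals: every element of `a` is below every element of `b`. -/
def SetBelow {A : Type*} [LT A] (a b : Set A) : Prop :=
  ∀ α ∈ a, ∀ β ∈ b, α < β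

/-- `𝒜 ⊆ [κ]^σ` consists of `κ` many pairwise disjoint sets. Here `κ` is identified with the
set of ordinals below its initial ordinal, and `[κ]^σ` is the collection of all subsets of `κ`
of order type `σ`. -/
structure IsDisjointFamily (κ : Cardinal.{u}) (σ : Ordinal.{u})
    (𝒜 : Set (Set (Set.Iio κ.ord))) : Prop where
  otp : ∀ a ∈ 𝒜, Ordinal.type (fun x y : a => x < y) = Ordinal.lift.{u + 1} σ
  card : Cardinal.mk 𝒜 = Cardinal.lift.{u + 1} κ
  disjoint : 𝒜.PairwiseDisjoint id

/-- The principle `pl₁(κ, θ, χ)`. The transformation `t` is applied to pairs `α < β` only (its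
values at other pairs are irrelevant), and `t α β = (τ*, α*, β*)`. -/
def PlOne (κ θ χ : Cardinal.{u}) : Prop :=
  ∃ t : Set.Iio κ.ord → Set.Iio κ.ord → Set.Iio κ.ord × Set.Iio κ.ord × Set.Iio κ.ord,
    (∀ α β, α < β → ∀ τ' α' β', t α β = (τ', α', β') → τ' ≤ α' ∧ α' ≤ α ∧ α < β' ∧ β' ≤ β) ∧
    ∀ σ < χ.ord, ∀ 𝒜 : Set (Set (Set.Iio κ.ord)), IsDisjointFamily κ σ 𝒜 →
      ∃ S : Set (Set.Iio κ.ord), IsStationary S ∧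
        ∀ α' ∈ S, ∀ β' ∈ S, α' < β' →
          ∀ τ' : Set.Iio κ.ord, (τ' : Ordinal.{u}) < min θ.ord α' →
            ∃ a ∈ 𝒜, ∃ b ∈ 𝒜, SetBelow a b ∧ Set.image2 t a b = {(τ', α', β')}

/-- Shelah's principle `pr₁(κ, κ, θ, χ)`. The colouring `c` is applied to pairs `α < β` only
(its values at other pairs are irrelevant). -/
def PrOne (κ θ χ : Cardinal.{u}) : Prop :=
  ∃ c : Set.Iio κ.ord → Set.Iio κ.ord → Set.Iio θ.ord,
    ∀ σ < χ.ord, ∀ 𝒜 : Set (Set (Set.Iio κ.ord)), IsDisjointFamily κ σ 𝒜 →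
      ∀ i : Set.Iio θ.ord, ∃ a ∈ 𝒜, ∃ b ∈ 𝒜, SetBelow a b ∧ Set.image2 c a b = {i}

/-! ### Clubs, diagonal intersections and Fodor's lemma on a regular uncountable order -/

section RegularOrder

open Cardinal Order Set

set_option linter.unusedSectionVars false

variable {X : Type*} [LinearOrder X] [WellFoundedLT X] [IsRegularCardinalOrder X]
  [NoMaxOrder X] [Uncountable X]

/-! The colour of `(α, β)` is the oscillation number `(oscSet (C α*) (C β*)).ncard`, where `t α β =
(τ*, α*, β*)` and `C` is a nontrivial C-sequence on `κ`. Since `t` is constant on suitable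
rectangles `a × b`, with any `α* < β*` from a stationary set as value, it is enough that oscillation
takes every finite value on pairs from each stationary set (`exists_ncard_oscSet_eq`). For this,
nontriviality and pressing down give stationary many `C α` with a common last point below
arbitrarily long gaps; prolonging two such stationary sets alternately adds one oscillation per
round (`exists_interleaved`). The sequence itself comes from `t`. Applied to singletons, the
principle makes `β*` meet every club strictly between `α` and `β`
(`exists_mem_isClub_of_transformation`). If `C β` consists of the closure points of `α ↦ β*`, such a
`β*` is not in `C β`; singular `β` are treated by a ladder (`exists_isNontrivialCSequence`). -/

theorem cof_ne_aleph0_of_uncountable : cof X ≠ ℵ₀ := by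
  rw [cof_eq_cardinalMk]
  exact (aleph0_lt_mk_iff.2 ‹_›).ne'

theorem exists_forall_lt_le (f : X → X) (β : X) : ∃ b, ∀ α < β, f α ≤ b := by
  have h : ¬ IsCofinal (f '' Iio β) := fun h ↦ by
    refine ((cof_le h).trans mk_image_le).not_gt ?_
    rw [cof_eq_cardinalMk]
    exact mk_Iio_lt β ord_cardinalMk
  obtain ⟨b, hb⟩ := not_isCofinal_iff.1 h
  exact ⟨b, fun α hα ↦ (hb _ ⟨α, hα, rfl⟩).le⟩

theorem exists_forall_nat_le (f : ℕ → X) : ∃ b, ∀ n, f n ≤ b := by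
  have h : ¬ IsCofinal (range f) := fun h ↦ by
    have h₁ := cof_le h
    rw [cof_eq_cardinalMk] at h₁
    have : (range f).Countable := countable_range f
    exact (h₁.trans (le_aleph0_iff_set_countable.2 this)).not_gt (aleph0_lt_mk_iff.2 ‹_›)
  obtain ⟨b, hb⟩ := not_isCofinal_iff.1 h
  exact ⟨b, fun n ↦ (hb _ ⟨n, rfl⟩).le⟩

theorem exists_isLeast_of_mem {X : Type*} [LinearOrder X] [WellFoundedLT X] {P : X → Prop} {b : X} (hb : P b) : ∃ a, IsLeast {x | P x} a :=
  ⟨WellFounded.min wellFounded_lt {x | P x} ⟨b, hb⟩, WellFounded.min_mem _ _ _,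
    fun _ hx ↦ WellFounded.min_le _ hx⟩

/-- The closure points of a function form a club. -/
theorem isClub_closurePoints (f : X → X) : IsClub {γ | ∀ α < γ, f α < γ} := by
  refine ⟨dirSupClosed_iff_of_linearOrder.2 fun t ht _ a ha α hα ↦ ?_, fun a ↦ ?_⟩
  · obtain ⟨ξ, hξ, hαξ⟩ := (lt_isLUB_iff ha).1 hα
    exact (ht hξ α hαξ).trans_le (ha.1 hξ)
  · choose g hg using exists_forall_lt_le f
    choose s hs using fun x : X ↦ exists_gt x
    let x : ℕ → X := fun n ↦ Nat.rec a (fun _ y ↦ s (max y (g y))) n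
    have hx : ∀ n, x n < x (n + 1) ∧ g (x n) < x (n + 1) := fun n ↦
      ⟨(le_max_left _ _).trans_lt (hs _), (le_max_right _ _).trans_lt (hs _)⟩
    obtain ⟨b, hb⟩ := exists_isLeast_of_mem (P := fun b ↦ ∀ n, x n ≤ b)
      (exists_forall_nat_le x).choose_spec
    refine ⟨b, fun α hα ↦ ?_, hb.1 0⟩
    have : ∃ n, α < x n := by
      by_contra! h
      exact (hb.2 h).not_gt hα
    obtain ⟨n, hn⟩ := this
    exact ((hg (x n) α hn).trans_lt (hx n).2).trans_le (hb.1 (n + 1))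

/-- The diagonal intersection of clubs is a club. -/
theorem isClub_diagInter {D : X → Set X} (hD : ∀ α, IsClub (D α)) :
    IsClub {γ | ∀ α < γ, γ ∈ D α} := by
  refine ⟨dirSupClosed_iff_of_linearOrder.2 fun t ht _ a ha α hα ↦ ?_, ?_⟩
  · obtain ⟨ξ, hξ, hαξ⟩ := (lt_isLUB_iff ha).1 hα
    refine (hD α).isLUB_mem (t := t ∩ Ioi α) (fun x hx ↦ ht hx.1 α hx.2) ⟨ξ, hξ, hαξ⟩
      ⟨fun x hx ↦ ha.1 hx.1, fun b hb ↦ ha.2 fun x hx ↦ ?_⟩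
    rcases lt_or_ge α x with h | h
    · exact hb ⟨hx, h⟩
    · exact h.trans (hαξ.le.trans (hb ⟨hξ, hαξ⟩))
  · choose s hs using fun x : X ↦ exists_gt x
    choose n hn hn' using fun α ξ ↦ (hD α).isCofinal (s ξ)
    -- `g ξ` bounds, for all `α ≤ ξ` at once, a point of `D α` beyond `ξ`; so a closure point of `g`
    -- is a limit of `D α` for each `α` below it.
    choose g hg using fun ξ ↦ exists_forall_lt_le (fun α ↦ n α ξ) (s ξ)
    refine (isClub_closurePoints g).isCofinal.mono fun γ hγ α hα ↦ ?_
    have key : ∀ ξ, α ≤ ξ → ξ < γ → n α ξ < γ := fun ξ h₁ h₂ ↦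
      (hg ξ α (h₁.trans_lt (hs ξ))).trans_lt (hγ ξ h₂)
    refine (hD α).isLUB_mem (t := D α ∩ Iio γ) inter_subset_left
      ⟨n α α, hn _ _, key α le_rfl hα⟩ ⟨fun x hx ↦ hx.2.le, fun b hb ↦ ?_⟩
    by_contra! h
    have h₁ := hb ⟨hn α (max α b), key _ (le_max_left _ _) (max_lt hα h)⟩
    exact (h₁.trans (le_max_right α b)).not_gt ((hs _).trans_le (hn' α (max α b)))

theorem IsStationary.inter_isClub {S D : Set X} (hS : IsStationary S) (hD : IsClub D) :
    IsStationary (S ∩ D) := fun t ht ↦ by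
  simpa [inter_assoc] using hS (hD.inter cof_ne_aleph0_of_uncountable ht)

theorem isClub_Ioi (γ : X) : IsClub (Ioi γ) := by
  refine ⟨dirSupClosed_iff_of_linearOrder.2 fun t ht ⟨x, hx⟩ a ha ↦ (ht hx).trans_le (ha.1 hx),
    fun a ↦ ?_⟩
  obtain ⟨b, hb⟩ := exists_gt (max a γ)
  exact ⟨b, (le_max_right _ _).trans_lt hb, ((le_max_left _ _).trans_lt hb).le⟩

theorem IsStationary.exists_mem_gt {S : Set X} (hS : IsStationary S) (γ : X) : ∃ β ∈ S, γ < β :=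
  hS (isClub_Ioi γ)

/-- Fodor's pressing down lemma. -/
theorem IsStationary.exists_isStationary_fiber {S : Set X} (hS : IsStationary S) {f : X → X}
    (hf : ∀ β ∈ S, f β < β) : ∃ c, IsStationary {β ∈ S | f β = c} := by
  by_contra! h
  simp_rw [not_isStationary_iff] at h
  choose D hD hD' using h
  obtain ⟨β, hβ, hβ'⟩ := hS (isClub_diagInter hD)
  exact (hD' (f β)).le_bot ⟨⟨hβ, rfl⟩, hβ' _ (hf β hβ)⟩

/-- Fodor's lemma for a relation. -/
theorem IsStationary.exists_isStationary_of_regressive {S : Set X} (hS : IsStationary S)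
    {P : X → X → Prop} (hP : ∀ β ∈ S, ∃ c < β, P β c) : ∃ c, IsStationary {β ∈ S | P β c} := by
  choose! f hf hf' using hP
  obtain ⟨c, hc⟩ := hS.exists_isStationary_fiber hf
  exact ⟨c, hc.mono fun β hβ ↦ ⟨hβ.1, hβ.2 ▸ hf' β hβ.1⟩⟩

end RegularOrder

/-! ### Oscillation along a nontrivial C-sequence -/

section Oscillation

open Cardinal Order Set

set_option linter.unusedSectionVars false

/-- The points of `x` above all common points of `x` and `y` which are the first point of `x`
above some point of `y` that is itself above all common points. -/
def oscSet {X : Type*} [LinearOrder X] (x y : Set X) : Set X :=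
  {ξ ∈ x | ∃ ν ∈ y, ν < ξ ∧ (∀ ζ ∈ x, ζ ∈ y → ζ < ν) ∧ ∀ ζ ∈ x, ν ≤ ζ → ξ ≤ ζ}

/-- A system of sets `C β ⊆ β` that are closed in `β`, cofinal in `β` for club many `β`, and such
that no club `D` satisfies `D ∩ β ⊆ C β` for stationary many `β`. -/
structure IsNontrivialCSequence {X : Type*} [LinearOrder X] (C : X → Set X) : Prop where
  lt : ∀ β, ∀ γ ∈ C β, γ < β
  closed : ∀ β, ∀ γ < β, (∀ α < γ, ∃ δ ∈ C β, α < δ ∧ δ ≤ γ) → γ ∈ C β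
  cofinal : ∃ E, IsClub E ∧ ∀ β ∈ E, ∀ α < β, ∃ γ ∈ C β, α < γ
  nontrivial : ∀ S, IsStationary S → ∀ D, IsClub D → ∃ β ∈ S, ∃ γ ∈ D, γ < β ∧ γ ∉ C β

/-- For every `γ`, stationary many `C α`, `α ∈ U`, have no point in the interval `(η, γ]`. -/
def HasHoles {X : Type*} [LinearOrder X] (C : X → Set X) (U : Set X) (η : X) : Prop :=
  ∀ γ, IsStationary {α ∈ U | ∀ ζ ∈ C α, ζ ≤ η ∨ γ < ζ}

variable {X : Type*} [LinearOrder X] [WellFoundedLT X] [IsRegularCardinalOrder X]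
  [NoMaxOrder X] [Uncountable X] {C : X → Set X}

theorem IsNontrivialCSequence.exists_hole_of_notMem (hC : IsNontrivialCSequence C) {β γ : X}
    (hγ : γ < β) (h : γ ∉ C β) : ∃ η < γ, ∀ ζ ∈ C β, ζ ≤ η ∨ γ < ζ := by
  by_contra! h'
  exact h (hC.closed β γ hγ h')

/-- Stationary many `γ` are omitted by stationary many `C β`, since otherwise a diagonal
intersection contradicts nontriviality. Closedness opens a gap below each omitted `γ`; pressing down
fixes its lower end, first over `β` and then over `γ`. -/
theorem IsNontrivialCSequence.exists_hasHoles (hC : IsNontrivialCSequence C) {S : Set X}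
    (hS : IsStationary S) : ∃ η, HasHoles C S η := by
  have hN : IsStationary {γ | IsStationary {β ∈ S | γ ∉ C β}} := by
    by_contra hN
    obtain ⟨D, hD, hDN⟩ := not_isStationary_iff.1 hN
    have : ∀ γ, ∃ E, IsClub E ∧ (γ ∈ D → Disjoint {β ∈ S | γ ∉ C β} E) := fun γ ↦ by
      by_cases hγ : γ ∈ D
      · have : ¬ IsStationary {β ∈ S | γ ∉ C β} := fun h ↦ hDN.le_bot ⟨h, hγ⟩
        obtain ⟨E, hE, h⟩ := not_isStationary_iff.1 this
        exact ⟨E, hE, fun _ ↦ h⟩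
      · exact ⟨univ, .univ, fun h ↦ absurd h hγ⟩
    choose E hE hE' using this
    obtain ⟨β, ⟨hβ, hβE⟩, γ, hγ, hγβ, hγC⟩ :=
      hC.nontrivial _ (hS.inter_isClub (isClub_diagInter hE)) D hD
    exact (hE' γ hγ).le_bot ⟨⟨hβ, hγC⟩, hβE γ hγβ⟩
  have h₁ : ∀ γ ∈ {γ | IsStationary {β ∈ S | γ ∉ C β}}, ∃ η < γ,
      IsStationary {β ∈ S | ∀ ζ ∈ C β, ζ ≤ η ∨ γ < ζ} := fun γ hγ ↦ by
    obtain ⟨η, hη⟩ := (hγ.inter_isClub (isClub_Ioi γ)).exists_isStationary_of_regressive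
      (P := fun β η ↦ η < γ ∧ ∀ ζ ∈ C β, ζ ≤ η ∨ γ < ζ) fun β hβ ↦ by
        obtain ⟨η, h, h'⟩ := hC.exists_hole_of_notMem hβ.2 hβ.1.2
        exact ⟨η, h.trans hβ.2, h, h'⟩
    obtain ⟨β, hβ⟩ := hη.nonempty
    exact ⟨η, hβ.2.1, hη.mono fun β hβ ↦ ⟨hβ.1.1.1, hβ.2.2⟩⟩
  obtain ⟨η, hη⟩ := hN.exists_isStationary_of_regressive h₁
  refine ⟨η, fun γ ↦ ?_⟩
  obtain ⟨γ', hγ', hγ⟩ := hη.exists_mem_gt γ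
  exact hγ'.2.mono fun β hβ ↦ ⟨hβ.1, fun ζ hζ ↦ (hβ.2 ζ hζ).imp_right hγ.trans⟩

/-- The least possible lower end of holes works: if it were mostly omitted, closedness and pressing
down would extend the holes to a smaller one. -/
theorem IsNontrivialCSequence.exists_hasHoles_mem (hC : IsNontrivialCSequence C) {S : Set X}
    (hS : IsStationary S) : ∃ η, HasHoles C {α ∈ S | η ∈ C α} η := by
  obtain ⟨η, hη, hmin⟩ := exists_isLeast_of_mem (hC.exists_hasHoles hS).choose_spec
  have h : ∀ η', ∃ γ, η' < η → ¬ IsStationary {α ∈ S | ∀ ζ ∈ C α, ζ ≤ η' ∨ γ < ζ} := fun η' ↦ by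
    by_cases h : η' < η
    · by_contra! h'
      exact (hmin fun γ ↦ (h' γ).2).not_gt h
    · exact ⟨η, fun h' ↦ absurd h' h⟩
  choose g hg using h
  -- `g η'` witnesses that `η' < η` is not a lower end; `b` bounds all these witnesses, so holes
  -- reaching past `b` refute any `η'`.
  obtain ⟨b, hb⟩ := exists_forall_lt_le g η
  refine ⟨η, fun γ ↦ ?_⟩
  have hT := (hη (max γ b)).inter_isClub (isClub_Ioi η)
  by_contra hns
  have hT' : IsStationary {α ∈ S | η < α ∧ η ∉ C α ∧ ∀ ζ ∈ C α, ζ ≤ η ∨ max γ b < ζ} := by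
    refine ((isStationary_union_iff cof_ne_aleph0_of_uncountable).1
      (hT.mono fun α hα ↦ ?_)).resolve_left hns
    by_cases h : η ∈ C α
    · exact .inl ⟨⟨hα.1.1, h⟩, fun ζ hζ ↦ (hα.1.2 ζ hζ).imp_right (le_max_left _ _).trans_lt⟩
    · exact .inr ⟨hα.1.1, hα.2, h, hα.1.2⟩
  obtain ⟨η', h'⟩ := hT'.exists_isStationary_of_regressive
    (P := fun α η' ↦ η' < η ∧ ∀ ζ ∈ C α, ζ ≤ η' ∨ η < ζ) fun α hα ↦ by
      obtain ⟨η', h, h'⟩ := hC.exists_hole_of_notMem hα.2.1 hα.2.2.1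
      exact ⟨η', h.trans hα.2.1, h, h'⟩
  obtain ⟨α, hα⟩ := h'.nonempty
  refine hg η' hα.2.1 (h'.mono fun β hβ ↦ ⟨hβ.1.1, fun ζ hζ ↦ ?_⟩)
  refine (hβ.2.2 ζ hζ).imp_right fun h ↦ ?_
  exact ((hb η' hα.2.1).trans (le_max_right γ b)).trans_lt
    ((hβ.1.2.2.2 ζ hζ).resolve_left h.not_ge)

/-- Prolong a hole at `η` beyond `γ` to the next point `p`, and find a new hole at `η'` beyond. -/
theorem IsNontrivialCSequence.exists_next_hole (hC : IsNontrivialCSequence C) {U : Set X} {η : X}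
    (hU : HasHoles C U η) (γ : X) : ∃ p > γ, ∃ η' ≥ p, ∃ U' ⊆ U, HasHoles C U' η' ∧
      ∀ α ∈ U', p ∈ C α ∧ η' ∈ C α ∧ ∀ ζ ∈ C α, ζ ≤ η ∨ p ≤ ζ := by
  obtain ⟨E, hE, hEC⟩ := hC.cofinal
  obtain ⟨p, hp⟩ := (((hU γ).inter_isClub hE).inter_isClub
    (isClub_Ioi (max γ η))).exists_isStationary_of_regressive
      (P := fun α p ↦ γ < p ∧ p ∈ C α ∧ ∀ ζ ∈ C α, ζ ≤ η ∨ p ≤ ζ) fun α hα ↦ by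
    obtain ⟨p₀, hp₀, hp₀'⟩ := hEC α hα.1.2 _ hα.2
    obtain ⟨p, hp, hmin⟩ := exists_isLeast_of_mem (P := fun p ↦ p ∈ C α ∧ max γ η < p) ⟨hp₀, hp₀'⟩
    refine ⟨p, hC.lt _ _ hp.1, (le_max_left _ _).trans_lt hp.2, hp.1, fun ζ hζ ↦ ?_⟩
    rcases hα.1.1.2 ζ hζ with h | h
    · exact .inl h
    · rcases le_or_gt ζ η with h' | h'
      · exact .inl h'
      · exact .inr (hmin ⟨hζ, max_lt h h'⟩)
  obtain ⟨η', hη'⟩ := hC.exists_hasHoles_mem hp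
  obtain ⟨α₀, hα₀⟩ := hp.nonempty
  refine ⟨p, hα₀.2.1, η', ?_, _, ?_, hη', fun α hα ↦ ⟨hα.1.2.2.1, hα.2, hα.1.2.2.2⟩⟩
  · obtain ⟨α, hα⟩ := (hη' p).nonempty
    exact (hα.2 p hα.1.1.2.2.1).resolve_right (lt_irrefl p)
  · exact fun α hα ↦ hα.1.1.1.1.1

/-- `η` is the last common point, `v` and `u` are where the holes of `V` and `U` begin, and `F`
collects the oscillation points so far. Each round adds `p > u` to the `V` side and then `q` beyond
the new `v'` to the `U` side; only `q` is a new oscillation point. -/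
theorem IsNontrivialCSequence.exists_interleaved (hC : IsNontrivialCSequence C) {S : Set X}
    (hS : IsStationary S) (n : ℕ) : ∃ η v u : X, ∃ U ⊆ S, ∃ V ⊆ S, ∃ F : Finset X, F.card = n ∧
      η ≤ v ∧ v < u ∧ HasHoles C U u ∧ HasHoles C V v ∧ (∀ ξ ∈ F, ξ ≤ u) ∧
      (∀ α ∈ U, η ∈ C α ∧ u ∈ C α) ∧ (∀ β ∈ V, η ∈ C β) ∧
      ∀ α ∈ U, ∀ β ∈ V, (∀ ζ ≤ v, ζ ∈ C α → ζ ∈ C β → ζ ≤ η) ∧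
        ∀ ξ, ξ ∈ F ↔ ξ ∈ C α ∧ ∃ ν ∈ C β, ν ≤ v ∧ ν < ξ ∧ η < ν ∧ ∀ ζ ∈ C α, ν ≤ ζ → ξ ≤ ζ := by
  induction n with
  | zero =>
    obtain ⟨η, hη⟩ := hC.exists_hasHoles_mem hS
    obtain ⟨p, hp, u, hu, U, hUS, hU, hU'⟩ := hC.exists_next_hole hη η
    refine ⟨η, η, u, U, hUS.trans (sep_subset _ _), _, sep_subset _ _, ∅, rfl, le_rfl,
      hp.trans_le hu, hU, hη, by simp, fun α hα ↦ ⟨(hUS hα).2, (hU' α hα).2.1⟩,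
      fun β hβ ↦ hβ.2, fun α hα β hβ ↦ ⟨fun ζ h _ _ ↦ h, fun ξ ↦ ?_⟩⟩
    simp only [Finset.notMem_empty, false_iff]
    rintro ⟨-, ν, -, h, -, h', -⟩
    exact h.not_gt h'
  | succ n ih =>
    obtain ⟨η, v, u, U, hUS, V, hVS, F, hF, hηv, hvu, hU, hV, hFu, hUη, hVη, h⟩ := ih
    obtain ⟨p, hp, v', hv', V', hVV, hV', hVp⟩ := hC.exists_next_hole hV u
    obtain ⟨q, hq, u', hu', U', hUU, hU', hUq⟩ := hC.exists_next_hole hU v'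
    have hqF : q ∉ F := fun hqF ↦ (hFu q hqF).not_gt (hp.trans (hv'.trans_lt hq))
    refine ⟨η, v', u', U', hUU.trans hUS, V', hVV.trans hVS, insert q F, ?_,
      hηv.trans (hvu.le.trans (hp.le.trans hv')), hq.trans_le hu', hU', hV', fun ξ hξ ↦ ?_,
      fun α hα ↦ ⟨(hUη α (hUU hα)).1, (hUq α hα).2.1⟩, fun β hβ ↦ hVη β (hVV hβ),
      fun α hα β hβ ↦ ?_⟩
    · rw [Finset.card_insert_of_notMem hqF, hF]
    · rcases Finset.mem_insert.1 hξ with rfl | hξ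
      · exact hu'
      · exact (hFu ξ hξ).trans (hp.le.trans (hv'.trans (hq.le.trans hu')))
    obtain ⟨h₁, h₂⟩ := h α (hUU hα) β (hVV hβ)
    obtain ⟨hqα, -, hα'⟩ := hUq α hα
    obtain ⟨hpβ, -, hβ'⟩ := hVp β hβ
    refine ⟨fun ζ hζ hζα hζβ ↦ ?_, fun ξ ↦ ?_⟩
    · rcases hβ' ζ hζβ with h' | h'
      · exact h₁ ζ h' hζα hζβ
      · rcases hα' ζ hζα with h'' | h''
        · exact absurd (hp.trans_le h') h''.not_gt
        · exact absurd (hq.trans_le h'') hζ.not_gt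
    · rw [Finset.mem_insert, h₂]
      constructor
      · rintro (rfl | ⟨hξ, ν, hν, hνv, hνξ, hην, hmin⟩)
        · refine ⟨hqα, p, hpβ, hv', hv'.trans_lt hq, hηv.trans_lt (hvu.trans hp), fun ζ hζ hpζ ↦ ?_⟩
          exact (hα' ζ hζ).resolve_left (hp.trans_le hpζ).not_ge
        · exact ⟨hξ, ν, hν, hνv.trans (hvu.le.trans (hp.le.trans hv')), hνξ, hην, hmin⟩
      · rintro ⟨hξ, ν, hν, hνv, hνξ, hην, hmin⟩
        rcases hβ' ν hν with h' | h'
        · exact .inr ⟨hξ, ν, hν, h', hνξ, hην, hmin⟩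
        · refine .inl (le_antisymm (hmin q hqα (hνv.trans hq.le)) ?_)
          exact (hα' ξ hξ).resolve_left (hp.trans_le (h'.trans hνξ.le)).not_ge

/-- The oscillation of `C α` and `C β` takes every finite value on every stationary set. -/
theorem IsNontrivialCSequence.exists_ncard_oscSet_eq (hC : IsNontrivialCSequence C) {S : Set X}
    (hS : IsStationary S) (n : ℕ) : ∃ α ∈ S, ∃ β ∈ S, α < β ∧ (oscSet (C α) (C β)).ncard = n := by
  obtain ⟨η, v, u, U, hUS, V, hVS, F, rfl, hηv, hvu, hU, hV, hFu, hUη, hVη, h⟩ :=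
    hC.exists_interleaved hS n
  obtain ⟨α, hα, -⟩ := (hU u).nonempty
  -- The hole of `C β` is chosen to cover `(v, α]`, so `C β` has no point below `α` other than those
  -- up to `v`.
  obtain ⟨β, ⟨hβ, hβα⟩, hαβ⟩ := (hV α).exists_mem_gt α
  refine ⟨α, hUS hα, β, hVS hβ, hαβ, ?_⟩
  obtain ⟨h₁, h₂⟩ := h α hα β hβ
  have hv : ∀ ζ ∈ C β, ζ < α → ζ ≤ v := fun ζ hζ h ↦ (hβα ζ hζ).resolve_right h.not_gt
  have hcommon : ∀ ν, (∀ ζ ∈ C α, ζ ∈ C β → ζ < ν) ↔ η < ν := fun ν ↦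
    ⟨fun h ↦ h η (hUη α hα).1 (hVη β hβ), fun h ζ hζ hζ' ↦
      (h₁ ζ (hv ζ hζ' (hC.lt _ _ hζ)) hζ hζ').trans_lt h⟩
  have : oscSet (C α) (C β) = F := by
    ext ξ
    rw [Finset.mem_coe, h₂]
    simp only [oscSet, mem_ofPred_eq, hcommon]
    refine and_congr_right fun hξ ↦ exists_congr fun ν ↦ and_congr_right fun hν ↦ ?_
    exact ⟨fun h ↦ ⟨hv ν hν (h.1.trans (hC.lt _ _ hξ)), h⟩, fun h ↦ h.2⟩
  rw [this, ncard_coe_finset]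

end Oscillation

/-! ### Construction of a nontrivial C-sequence -/

section CSequence

open Cardinal Order Set

set_option linter.unusedSectionVars false

/-- `β` has a cofinal subset indexed by a proper initial segment of `β`. -/
def IsSingularPoint {X : Type*} [LinearOrder X] (β : X) : Prop :=
  ∃ l < β, ∃ f : X → X, (∀ i < l, f i < β) ∧ ∀ α < β, ∃ i < l, α ≤ f i

variable {X : Type*} [LinearOrder X] [WellFoundedLT X] [IsRegularCardinalOrder X]
  [NoMaxOrder X] [Uncountable X]

/-- For a cofinal `f` of least length `l`, let `r α` be the least index with `α ≤ f (r α)`, and `h α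
= f (r α)`. A closure point `γ'` above `γ` exceeds `f (r γ)`, so `r` grows strictly. Minimality of
`l` bounds proper initial parts of `f` below `β`, which makes closure points cofinal. -/
theorem IsSingularPoint.exists_ladder {β : X} (hβ : IsSingularPoint β)
    (hlim : ∀ α < β, ∃ α' < β, α < α') : ∃ h r : X → X, ∃ l < β, (∀ α < β, r α < l) ∧
      (∀ γ γ', γ < γ' → γ' < β → (∀ α < γ', h α < γ') → r γ < r γ') ∧
      ∀ α < β, ∃ γ < β, α < γ ∧ ∀ ξ < γ, h ξ < γ := by
  obtain ⟨l₀, hl₀, h₀⟩ := hβ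
  obtain ⟨l, ⟨f, hf, hfc⟩, hmin⟩ := exists_isLeast_of_mem
    (P := fun l ↦ ∃ f : X → X, (∀ i < l, f i < β) ∧ ∀ α < β, ∃ i < l, α ≤ f i) h₀
  have hr : ∀ α, ∃ i, α < β → IsLeast {i | i < l ∧ α ≤ f i} i := fun α ↦ by
    by_cases hα : α < β
    · obtain ⟨i, hi⟩ := hfc α hα
      obtain ⟨j, hj⟩ := exists_isLeast_of_mem (P := fun i ↦ i < l ∧ α ≤ f i) hi
      exact ⟨j, fun _ ↦ hj⟩
    · exact ⟨α, fun h ↦ absurd h hα⟩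
  choose r hr using hr
  refine ⟨fun α ↦ f (r α), r, l, (hmin h₀).trans_lt hl₀, fun α hα ↦ (hr α hα).1.1,
    fun γ γ' h hγ' hcl ↦ ?_, fun α hα ↦ ?_⟩
  · have h₁ := hr γ' hγ'
    by_contra! hle
    rcases hle.eq_or_lt with he | hlt
    · exact (hcl γ h).not_ge (h₁.1.2.trans_eq (congrArg f he))
    · exact hlt.not_ge ((hr γ (h.trans hγ')).2 ⟨h₁.1.1, h.le.trans h₁.1.2⟩)
  · obtain ⟨hi, hαi⟩ := (hr α hα).1
    have : ∃ a < β, ∀ j < r α, f j < a := by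
      by_contra! h'
      exact (hmin ⟨f, fun i h ↦ hf i (h.trans hi), h'⟩).not_gt hi
    obtain ⟨a, ha, ha'⟩ := this
    obtain ⟨b, hb, hb'⟩ := hlim _ (max_lt ha (hf _ hi))
    have hbound : ∀ j ≤ r α, f j < b := fun j hj ↦ by
      rcases hj.eq_or_lt with rfl | hj
      · exact (le_max_right _ _).trans_lt hb'
      · exact (ha' j hj).trans ((le_max_left _ _).trans_lt hb')
    obtain ⟨γ, hγ, hγmin⟩ := exists_isLeast_of_mem (P := fun b ↦ ∀ j ≤ r α, f j < b) hbound
    have hγβ := (hγmin hbound).trans_lt hb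
    refine ⟨γ, hγβ, hαi.trans_lt (hγ _ le_rfl), fun ξ hξ ↦ ?_⟩
    have : ∃ j ≤ r α, ξ ≤ f j := by
      by_contra! h'
      exact (hγmin h').not_gt hξ
    obtain ⟨j, hj, hj'⟩ := this
    exact hγ _ (((hr ξ (hξ.trans hγβ)).2 ⟨hj.trans_lt hi, hj'⟩).trans hj)

/-- Indexes sequences of length `ω` by an initial segment of `X`, so that they are bounded below any
non-singular limit point above `w`. -/
theorem exists_nat_labelling : ∃ (w : X) (e : X → ℕ), ∀ n, ∃ i < w, e i = n := by
  obtain ⟨x, hx⟩ := Nat.exists_strictMono X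
  obtain ⟨b, hb⟩ := exists_forall_nat_le x
  obtain ⟨w, hw⟩ := exists_gt b
  exact ⟨w, Function.invFun x, fun n ↦
    ⟨x n, (hb n).trans_lt hw, Function.leftInverse_invFun hx.injective n⟩⟩

theorem exists_closurePoint_of_not_isSingularPoint {w β : X} {e : X → ℕ}
    (hw : ∀ n, ∃ i < w, e i = n) (hwβ : w < β) (hβ : ¬ IsSingularPoint β)
    (hlim : ∀ α < β, ∃ α' < β, α < α') {h : X → X} (hh : ∀ α < β, h α < β) {a : X} (ha : a < β) :
    ∃ γ < β, a < γ ∧ ∀ ξ < γ, h ξ < γ := by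
  have hbd : ∀ l < β, ∀ f : X → X, (∀ i < l, f i < β) → ∃ b < β, ∀ i < l, f i < b := by
    intro l hl f hf
    by_contra! h'
    exact hβ ⟨l, hl, f, hf, h'⟩
  have hs : ∀ x : Iio β, ∃ y : Iio β, x < y ∧ ∀ i < x.1, h i < y := fun x ↦ by
    obtain ⟨b, hb, hb'⟩ := hbd x x.2 h fun i hi ↦ hh i (hi.trans x.2)
    obtain ⟨y, hy, hy'⟩ := hlim _ (max_lt x.2 hb)
    exact ⟨⟨y, hy⟩, (le_max_left x.1 b).trans_lt hy', fun i hi ↦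
      (hb' i hi).trans ((le_max_right _ _).trans_lt hy')⟩
  choose s hs hs' using hs
  let x : ℕ → Iio β := fun n ↦ s^[n] ⟨a, ha⟩
  have hx : ∀ n, x (n + 1) = s (x n) := fun n ↦ Function.iterate_succ_apply' _ _ _
  obtain ⟨b, hb, hb'⟩ := hbd w hwβ (fun i ↦ x (e i)) fun i _ ↦ (x (e i)).2
  have hbx : ∀ n, (x n).1 < b := fun n ↦ by
    obtain ⟨i, hi, rfl⟩ := hw n
    exact hb' i hi
  obtain ⟨γ, hγ, hγmin⟩ := exists_isLeast_of_mem (P := fun b ↦ ∀ n, (x n).1 < b) hbx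
  refine ⟨γ, (hγmin hbx).trans_lt hb, hγ 0, fun ξ hξ ↦ ?_⟩
  have : ∃ n, ξ ≤ x n := by
    by_contra! h'
    exact (hγmin h').not_gt hξ
  obtain ⟨n, hn⟩ := this
  have h₁ : ξ < x (n + 1) := hn.trans_lt (by rw [hx]; exact hs (x n))
  have h₂ : h ξ < x (n + 2) := by
    rw [hx (n + 1)]
    exact hs' (x (n + 1)) ξ h₁
  exact h₂.trans (hγ _)

/-- A function whose values catch every club, even below elements of a given stationary set,
gives rise to a nontrivial `C`-sequence. -/
theorem exists_isNontrivialCSequence {g : X → X → X}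
    (hg : ∀ S, IsStationary S → ∀ D, IsClub D →
      ∃ α, ∃ β ∈ S, α < g α β ∧ g α β < β ∧ g α β ∈ D) :
    ∃ C : X → Set X, IsNontrivialCSequence C := by
  obtain ⟨w, e, hw⟩ := exists_nat_labelling (X := X)
  choose s hs using fun x : X ↦ exists_gt x
  have key : ∀ β, ∃ h : X → X, ((w < β ∧ ∀ α < β, s α < β) →
      ∀ α < β, ∃ γ < β, α < γ ∧ ∀ ξ < γ, h ξ < γ) ∧
      (IsSingularPoint β → (w < β ∧ ∀ α < β, s α < β) → ∃ r : X → X, ∃ l < β,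
        (∀ α < β, r α < l) ∧ ∀ γ γ', γ < γ' → γ' < β → (∀ α < γ', h α < γ') → r γ < r γ') ∧
      (¬ IsSingularPoint β → ∀ α, g α β < β → h α = g α β) := fun β ↦ by
    by_cases hlim : w < β ∧ ∀ α < β, s α < β
    · have hlim' : ∀ α < β, ∃ α' < β, α < α' := fun α hα ↦ ⟨s α, hlim.2 α hα, hs α⟩
      by_cases hβ : IsSingularPoint β
      · obtain ⟨h, r, l, hl, hr, hr', hc⟩ := hβ.exists_ladder hlim'
        exact ⟨h, fun _ ↦ hc, fun _ _ ↦ ⟨r, l, hl, hr, hr'⟩, fun h ↦ absurd hβ h⟩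
      -- The default value `α` keeps the function below `β` and imposes no closure condition.
      · refine ⟨fun α ↦ if g α β < β then g α β else α, fun _ α hα ↦ ?_, fun h ↦ absurd h hβ,
          fun _ α hα ↦ if_pos hα⟩
        refine exists_closurePoint_of_not_isSingularPoint hw hlim.1 hβ hlim' (fun α hα ↦ ?_) hα
        split_ifs with h'
        exacts [h', hα]
    · exact ⟨fun α ↦ g α β, fun h ↦ absurd h hlim, fun _ h ↦ absurd h hlim, fun _ _ _ ↦ rfl⟩
  choose h hcof hsing hreg using key
  have hE : IsClub {β | w < β ∧ ∀ α < β, s α < β} :=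
    (isClub_Ioi w).inter cof_ne_aleph0_of_uncountable (isClub_closurePoints s)
  refine ⟨fun β ↦ {γ | γ < β ∧ ∀ α < γ, h β α < γ}, fun β γ hγ ↦ hγ.1,
    fun β γ hγ H ↦ ⟨hγ, fun α hα ↦ ?_⟩, ⟨_, hE, fun β hβ α hα ↦ ?_⟩, fun S hS D hD ↦ ?_⟩
  · obtain ⟨δ, hδ, hαδ, hδγ⟩ := H α hα
    exact (hδ.2 α hαδ).trans_le hδγ
  · obtain ⟨γ, h₁, h₂, h₃⟩ := hcof β hβ α hα
    exact ⟨γ, ⟨h₁, h₃⟩, h₂⟩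
  by_contra! hSD
  have hS' : IsStationary {β ∈ S | IsSingularPoint β} ∨
      IsStationary {β ∈ S | ¬ IsSingularPoint β} := by
    refine (isStationary_union_iff cof_ne_aleph0_of_uncountable).1 (hS.mono fun β hβ ↦ ?_)
    by_cases h : IsSingularPoint β
    exacts [.inl ⟨hβ, h⟩, .inr ⟨hβ, h⟩]
  rcases hS' with hS' | hS'
  -- Singular case: with the bound `l` of the ranks fixed, `D ∩ β ⊆ C β` would make `r ∘ d` strictly
  -- increasing on `[0, l]` with values below `l`.
  · obtain ⟨l, hl⟩ := (hS'.inter_isClub hE).exists_isStationary_of_regressive fun β hβ ↦ by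
      obtain ⟨r, l, hl, hr⟩ := hsing β hβ.1.2 hβ.2
      exact ⟨l, hl, (⟨r, hr⟩ : ∃ r : X → X, (∀ α < β, r α < l) ∧
        ∀ γ γ', γ < γ' → γ' < β → (∀ α < γ', h β α < γ') → r γ < r γ')⟩
    let d : X → X := fun x ↦ (enum D hD.isCofinal x).1
    have hd : StrictMono d := fun x y hxy ↦ (enum D hD.isCofinal).strictMono hxy
    obtain ⟨β, ⟨⟨⟨hβS, -⟩, -⟩, r, hr, hr'⟩, hβ⟩ := hl.exists_mem_gt (d l)
    have hle : ∀ ξ ≤ l, ξ ≤ r (d ξ) := fun ξ ↦ by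
      induction ξ using WellFoundedLT.induction with
      | ind ξ ih =>
        intro hξ
        refine le_of_forall_lt fun ζ hζ ↦ (ih ζ hζ (hζ.le.trans hξ)).trans_lt ?_
        have h₁ := (hd.monotone hξ).trans_lt hβ
        exact hr' _ _ (hd hζ) h₁ (hSD β hβS _ (enum D hD.isCofinal ξ).2 h₁).2
    exact (hle l le_rfl).not_gt (hr _ hβ)
  -- Regular case: `g α β` cannot be a closure point of `h β`, since `α` lies below it and `h β α =
  -- g α β`.
  · obtain ⟨α, β, hβ, hα, hlt, hgD⟩ := hg _ hS' D hD
    have h₁ := (hSD β hβ.1 _ hgD hlt).2 α hα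
    rw [hreg β hβ.2 α hlt] at h₁
    exact h₁.false

end CSequence

/-! ### The transformation on singletons -/

section Transformation

open Cardinal Order Set

theorem isRegularCardinalOrder_Iio_ord {κ : Cardinal.{u}} (hκ : κ.IsRegular) :
    IsRegularCardinalOrder (Iio κ.ord) where
  type_lt_le_ord_cof := by
    rw [Ordinal.cof_Iio]
    simp [hκ.lift.cof_ord]

theorem mk_eq_lift_of_isCofinal {κ : Cardinal.{u}} (hκ : κ.IsRegular) {A : Set (Iio κ.ord)}
    (hA : IsCofinal A) : #A = Cardinal.lift.{u + 1} κ := by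
  refine le_antisymm ((mk_subtype_le _).trans ?_) ((cof_le hA).trans' ?_)
  · rw [mk_Iio_ordinal, card_ord]
  · rw [Ordinal.cof_Iio]
    simp [hκ.lift.cof_ord]

theorem isDisjointFamily_singletons {κ : Cardinal.{u}} (hκ : κ.IsRegular) {A : Set (Iio κ.ord)}
    (hA : IsCofinal A) : IsDisjointFamily κ 1 (singleton '' A) where
  otp := by
    rintro _ ⟨x, -, rfl⟩
    rw [Ordinal.lift_one]
    exact Ordinal.type_eq_one_of_unique _
  card := by
    rw [mk_image_eq singleton_injective, mk_eq_lift_of_isCofinal hκ hA]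
  disjoint := by
    rintro _ ⟨x, -, rfl⟩ _ ⟨y, -, rfl⟩ hxy
    exact disjoint_singleton.2 fun h ↦ hxy (h ▸ rfl)

theorem IsDisjointFamily.ne_zero {κ : Cardinal.{u}} (hκ : 1 < κ) {σ : Ordinal.{u}}
    {𝒜 : Set (Set (Iio κ.ord))} (h𝒜 : IsDisjointFamily κ σ 𝒜) : σ ≠ 0 := by
  rintro rfl
  have hsub : 𝒜 ⊆ {∅} := fun a ha ↦ by
    have := h𝒜.otp a ha
    rw [Ordinal.lift_zero, Ordinal.type_eq_zero_iff_isEmpty] at this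
    exact isEmpty_coe_sort.1 this
  have := mk_le_mk_of_subset hsub
  rw [h𝒜.card, mk_singleton, lift_le_one_iff] at this
  exact this.not_gt hκ

/-- A transformation as in `PlOne`, restricted to families of singletons, catches every club. -/
theorem exists_mem_isClub_of_transformation {κ : Cardinal.{u}} (hκ : κ.IsRegular)
    [IsRegularCardinalOrder (Iio κ.ord)] [NoMaxOrder (Iio κ.ord)] [Uncountable (Iio κ.ord)]
    {t : Iio κ.ord → Iio κ.ord → Iio κ.ord × Iio κ.ord × Iio κ.ord}
    (ht : ∀ α β, α < β → ∀ τ' α' β', t α β = (τ', α', β') → τ' ≤ α' ∧ α' ≤ α ∧ α < β' ∧ β' ≤ β)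
    (ht' : ∀ 𝒜 : Set (Set (Iio κ.ord)), IsDisjointFamily κ 1 𝒜 →
      ∃ S : Set (Iio κ.ord), IsStationary S ∧ ∀ α' ∈ S, ∀ β' ∈ S, α' < β' →
        ∀ τ' : Iio κ.ord, (τ' : Ordinal.{u}) < min (ord 1) α' →
          ∃ a ∈ 𝒜, ∃ b ∈ 𝒜, SetBelow a b ∧ Set.image2 t a b = {(τ', α', β')})
    {S D : Set (Iio κ.ord)} (hS : IsStationary S) (hD : IsClub D) :
    ∃ α, ∃ β ∈ S, α < (t α β).2.2 ∧ (t α β).2.2 < β ∧ (t α β).2.2 ∈ D := by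
  choose n hnS hn using hS.exists_mem_gt
  -- Only points of `S` that are not limits of `S` are used: choosing `β*` closed under `n`, hence a
  -- limit of `S`, then forces `β* ≠ β`.
  let A : Set (Iio κ.ord) := {β ∈ S | ∃ δ < β, ∀ ξ ∈ S, ξ < β → ξ ≤ δ}
  have hA : IsCofinal A := fun δ ↦ by
    obtain ⟨β, hβ, hmin⟩ := exists_isLeast_of_mem (P := fun β ↦ β ∈ S ∧ δ < β) ⟨hnS δ, hn δ⟩
    exact ⟨β, ⟨hβ.1, δ, hβ.2, fun ξ hξ hξβ ↦ not_lt.1 fun h ↦ (hmin ⟨hξ, h⟩).not_gt hξβ⟩, hβ.2.le⟩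
  obtain ⟨T, hT, hTA⟩ := ht' _ (isDisjointFamily_singletons hκ hA)
  let z : Iio κ.ord := ⟨0, hκ.ord_pos⟩
  obtain ⟨α', hα', hzα⟩ := hT.exists_mem_gt z
  obtain ⟨β', ⟨⟨hβ', hβD⟩, hβn⟩, hαβ'⟩ :=
    ((hT.inter_isClub hD).inter_isClub (isClub_closurePoints n)).exists_mem_gt α'
  obtain ⟨_, ⟨α, hα, rfl⟩, _, ⟨β, hβ, rfl⟩, hαβ, him⟩ := hTA α' hα' β' hβ' hαβ' z
    (lt_min (by simp [z]) hzα)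
  have hlt : α < β := hαβ α rfl β rfl
  have htαβ : t α β = (z, α', β') := by simpa using him
  obtain ⟨-, -, h₁, h₂⟩ := ht α β hlt _ _ _ htαβ
  rw [← show (t α β).2.2 = β' by rw [htαβ]] at h₁ h₂ hβD hβn
  refine ⟨α, β, hβ.1, h₁, h₂.lt_of_ne fun h ↦ ?_, hβD⟩
  rw [h] at hβn
  obtain ⟨-, δ, hδ, hmax⟩ := hβ
  exact (hmax _ (hnS δ) (hβn δ hδ)).not_gt (hn δ)

end Transformation

/-! ### The colouring -/

theorem mainTheorem8 (κ χ : Cardinal.{u}) (hκ : κ.IsRegular) (hκ' : Cardinal.aleph0 < κ)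
    (hχ : χ ≤ κ) (h : PlOne κ 1 χ) : PrOne κ Cardinal.aleph0 χ := by
  obtain ⟨t, ht, hpl⟩ := h
  have : IsRegularCardinalOrder (Set.Iio κ.ord) := isRegularCardinalOrder_Iio_ord hκ
  have : NoMaxOrder (Set.Iio κ.ord) :=
    ⟨fun a ↦ ⟨⟨Order.succ a.1, (Cardinal.isSuccLimit_ord hκ.aleph0_le).succ_lt a.2⟩,
      Order.lt_succ a.1⟩⟩
  have : Uncountable (Set.Iio κ.ord) := by
    rw [← Cardinal.aleph0_lt_mk_iff, Cardinal.mk_Iio_ordinal, Cardinal.card_ord]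
    simpa using hκ'
  have hone : (1 : Ordinal.{u}) < χ.ord → ∃ C, IsNontrivialCSequence (X := Set.Iio κ.ord) C :=
    fun hχ' ↦ exists_isNontrivialCSequence fun S hS D hD ↦
      exists_mem_isClub_of_transformation hκ ht (hpl 1 hχ') hS hD
  have hω : ∀ n : ℕ, (n : Ordinal.{u}) < Cardinal.aleph0.ord := fun n ↦ by
    rw [Cardinal.ord_aleph0]
    exact Ordinal.natCast_lt_omega0 n
  by_cases hχ' : (1 : Ordinal.{u}) < χ.ord
  · obtain ⟨C, hC⟩ := hone hχ'
    refine ⟨fun α β ↦ ⟨(oscSet (C (t α β).2.1) (C (t α β).2.2)).ncard, hω _⟩,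
      fun σ hσ 𝒜 h𝒜 ⟨i, hi⟩ ↦ ?_⟩
    obtain ⟨S, hS, hSt⟩ := hpl σ hσ 𝒜 h𝒜
    obtain ⟨n, rfl⟩ := Ordinal.lt_omega0.1 (by simpa using hi)
    let z : Set.Iio κ.ord := ⟨0, hκ.ord_pos⟩
    obtain ⟨α', hα', β', hβ', hαβ, hn⟩ :=
      -- As `θ = 1`, only `τ* = 0` is available, and it requires `0 < α*`.
      hC.exists_ncard_oscSet_eq (hS.inter_isClub (isClub_Ioi z)) n
    obtain ⟨a, ha, b, hb, hab, him⟩ := hSt α' hα'.1 β' hβ'.1 hαβ z (lt_min (by simp [z]) hα'.2)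
    refine ⟨a, ha, b, hb, hab, ?_⟩
    have := congrArg (Set.image fun p : Set.Iio κ.ord × Set.Iio κ.ord × Set.Iio κ.ord ↦
      (⟨(oscSet (C p.2.1) (C p.2.2)).ncard, hω _⟩ : Set.Iio Cardinal.aleph0.ord)) him
    rw [Set.image_image2, Set.image_singleton] at this
    rw [this]
    simp only [hn]
  -- For `χ ≤ 1` only `σ = 0` could occur, but there is just one empty set, so no family exists and
  -- any colouring works.
  · refine ⟨fun _ _ ↦ ⟨0, by simp⟩, fun σ hσ 𝒜 h𝒜 ↦ ?_⟩
    refine absurd ?_ (h𝒜.ne_zero (Cardinal.one_lt_aleph0.trans hκ'))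
    exact Order.lt_one_iff.1 (hσ.trans_le (not_lt.1 hχ'))
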